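/- A problem on a universe $U$ takes as input a finite set $X\subseteq U$ of points with positive weights from a given set $\mathcal W$ of allowed weights ($\mathcal W=\{1\}$ for unweighted inputs), and specifies for each input a set of feasible solutions, each of which has an underlying finite set of points of $U$. The problem is compliant if, for every input $X$, every feasible solution is a subset of $X$, and is nonempty if $X$ is nonempty. A fully-dynamic algorithm starts with the empty input and supports inserting an absent point with an allowed weight, deleting a present point, and querying, which returns a solution for the current input. It is randomized. Its memory between operations is a bit string, and each operation maps the current memory to a random new memory (and, for a query, a random answer) by an arbitrary transition law, with fresh randomness. An adaptive adversary chooses each operation as a function of all previous operations and answers. The algorithm solves the problem in the presence of an adaptive adversary with success probability $1-1/(8n^2)$ if, for every adaptive adversary, every $t$ and every $n\ge 1$, the probability that the $t$-th operation is a query asked when the current input has exactly $n$ points and that it is answered by an infeasible solution is at most $1/(8n^2)$. **Theorem 4.1.** Every fully-dynamic algorithm that solves a compliant problem in the presence of an adaptive adversary with success probability $1-1/(8n^2)$, where $n$ is the current input size, uses $\Omega(n)$ space. Precisely, let $U$ be the universe and $w\in\mathcal W$, $w>0$. 1. For every $n\ge 1$ with $2n\le |U|$ there are $n$ distinct points of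 $U$ such that, after inserting exactly these points with weight $w$ in some order into the empty input, the memory has with positive probability at least $\tfrac{2}{11}n$ bits. 2. For every $n\ge 2$ with $n\le |U|$ there are at most $n$ distinct points of $U$ such that, after inserting exactly these points with weight $w$ in some order into the empty input, the memory has with positive probability at least $\tfrac{2}{11}n$ bits. Moreover, the following problems on a metric space $(U,d)$ are compliant, for every $k\ge 1$ (in particular $k=1$), where the cost of $S$ on $X$ is $c(S,X)=\sum_{x\in X}w(x)\min_{s\in S}d(x,s)^z$ with $z=1$ ($k$-median) or $z=2$ ($k$-means), the minimum over the empty set is $\infty$, and the query space consists of the subsets of $X$ of cardinality at most $k$: for every finite $\alpha\ge 0$, finding an $S$ in the query space with $c(S,X)\le\alpha\cdot\min_T c(T,X)$, where $T$ ranges over the query space; and, for every finite $\varepsilon\ge 0$, finding an $\varepsilon$-coreset, i.e. a weighted set $C\subseteq X$ with $(1-\varepsilon)\,c(S,C)\le c(S,X)\le(1+\varepsilon)\,c(S,C)$ for every $S$ in the query space, where $1-\varepsilon$ is replaced by $0$ if $\varepsilon>1$. -/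

import Mathlib

open scoped NNReal ENNReal

universe u v

/-- A problem on the universe `U` with solutions of type `O`. A weighted set of points is a vector
`X : U →₀ ℝ≥0`; its underlying set is `X.support` and its size is `X.support.card`.
`weights` is the set of weights that a point may carry: `{1}` for unweighted inputs, `Set.Ioi 0`
for arbitrary positive real weights, and so on. `points o` is the underlying set of points of the
solution `o` (solutions may carry further data, for instance the weights of a coreset), and
`feasible X` is the set of feasible solutions on the input `X`. -/
structure Problem (U : Type u) (O : Type v) where
  weights : Set ℝ≥0
  points : O → Finset U
  feasible : (U →₀ ℝ≥0) → Set O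

/-- All points of `X` carry a weight that the problem allows. -/
def Problem.Admissible {U : Type u} {O : Type v} (P : Problem U O) (X : U →₀ ℝ≥0) : Prop :=
  ∀ p ∈ X.support, X p ∈ P.weights

/-- Feasible solutions are subsets of the input, and nonempty ones if the input is nonempty. -/
def Problem.Compliant {U : Type u} {O : Type v} (P : Problem U O) : Prop :=
  ∀ X : U →₀ ℝ≥0, P.Admissible X → ∀ o ∈ P.feasible X,
    P.points o ⊆ X.support ∧ (X.support.Nonempty → (P.points o).Nonempty)

/-- The operations of the fully-dynamic model. -/
inductive DynOp (U : Type u) where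
  | insert (p : U) (w : ℝ≥0)
  | delete (p : U)
  | query

/-- A randomized fully-dynamic algorithm. Its memory between two operations is a bit string; every
operation maps the current memory to a random new memory (using fresh random bits), and a query
also returns a solution. All information carried from one operation to the next, including random
bits to be reused, is in the memory. The transition maps are arbitrary. -/
structure DynAlg (U : Type u) (O : Type v) where
  init : PMF (List Bool)
  insert : U → ℝ≥0 → List Bool → PMF (List Bool)
  delete : U → List Bool → PMF (List Bool)
  query : List Bool → PMF (List Bool × O)

/-- A transcript, latest entry first: the operations with the answers (`none` for an update). -/
abbrev Transcript (U : Type u) (O : Type v) := List (DynOp U × Option O)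

/-- An adaptive adversary: it picks the next operation from the operations and answers so far
(it does not see the memory or the random bits of the algorithm). -/
abbrev Adversary (U : Type u) (O : Type v) := Transcript U O → DynOp U

/-- The effect of an operation on the input. -/
noncomputable def DynOp.apply {U : Type u} : DynOp U → (U →₀ ℝ≥0) → (U →₀ ℝ≥0)
  | .insert p w, X => X.update p w
  | .delete p, X => X.erase p
  | .query, X => X

/-- The current input after a transcript; the initial input is empty. -/
noncomputable def currentInput {U : Type u} {O : Type v} : Transcript U O → (U →₀ ℝ≥0)
  | [] => 0
  | e :: h => e.1.apply (currentInput h)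

/-- Only absent points are inserted, with an allowed positive weight; only present points are
deleted. -/
def Problem.LegalOp {U : Type u} {O : Type v} (P : Problem U O) (X : U →₀ ℝ≥0) : DynOp U → Prop
  | .insert p w => p ∉ X.support ∧ 0 < w ∧ w ∈ P.weights
  | .delete p => p ∈ X.support
  | .query => True

/-- An adversary that only issues legal operations. -/
def Problem.LegalAdversary {U : Type u} {O : Type v} (P : Problem U O)
    (adv : Adversary U O) : Prop :=
  ∀ h : Transcript U O, P.LegalOp (currentInput h) (adv h)

namespace DynAlg

variable {U : Type u} {O : Type v}

/-- One operation: the joint law of the new memory and the answer. -/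
noncomputable def step (A : DynAlg U O) (m : List Bool) :
    DynOp U → PMF (List Bool × Option O)
  | .insert p w => (A.insert p w m).map fun m' => (m', none)
  | .delete p => (A.delete p m).map fun m' => (m', none)
  | .query => (A.query m).map fun r => (r.1, some r.2)

/-- The joint law of memory and transcript after `t` operations against `adv`. -/
noncomputable def run (A : DynAlg U O) (adv : Adversary U O) :
    ℕ → PMF (List Bool × Transcript U O)
  | 0 => A.init.map fun m => (m, [])
  | t + 1 => (A.run adv t).bind fun c =>
      (A.step c.1 (adv c.2)).map fun r => (r.1, (adv c.2, r.2) :: c.2)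

/-- The algorithm solves `P` in the presence of an adaptive adversary, with failure probability at
most `δ n` when the current input has `n` points: whatever the adversary does, for every `n ≥ 1`,
the probability that operation number `t + 1` is a query, asked when the current input has size
`n`, and is answered by an infeasible solution is at most `δ n`. -/
def WorksAgainstAdaptiveAdversary (A : DynAlg U O) (P : Problem U O) (δ : ℕ → ℝ≥0∞) : Prop :=
  ∀ adv : Adversary U O, P.LegalAdversary adv → ∀ t n : ℕ, 1 ≤ n →
    (A.run adv (t + 1)).toOuterMeasure
      {c | ∃ (o : O) (h : Transcript U O), c.2 = (DynOp.query, some o) :: h ∧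
        (currentInput h).support.card = n ∧ o ∉ P.feasible (currentInput h)} ≤ δ n

/-- The law of the memory after inserting the points of a list (last entry first), each with
weight `w`, into the initially empty input. -/
noncomputable def memoryAfterInserting (A : DynAlg U O) (w : ℝ≥0) : List U → PMF (List Bool)
  | [] => A.init
  | p :: l => (A.memoryAfterInserting w l).bind (A.insert p w)

end DynAlg

/-! Examples: approximation and coresets for `k`-median (`z = 1`) and `k`-means (`z = 2`). -/

/-- `∑ x, w x * min_{s ∈ S} d(x, s) ^ z`, where the minimum over the empty set is `∞`. -/
noncomputable def clusterCost {U : Type u} [MetricSpace U] (z : ℕ) (S : Finset U)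
    (X : U →₀ ℝ≥0) : ℝ≥0∞ :=
  X.sum fun x w => (w : ℝ≥0∞) * ⨅ s ∈ S, edist x s ^ z

/-- The query space: the subsets of the input with at most `k` points. -/
def clusterSolutions {U : Type u} (k : ℕ) (X : U →₀ ℝ≥0) : Set (Finset U) :=
  {S | S ⊆ X.support ∧ S.card ≤ k}

/-- Computing an `α`-approximate solution. -/
noncomputable def clusterApproxProblem (U : Type u) [MetricSpace U] (W : Set ℝ≥0) (z k : ℕ)
    (α : ℝ≥0) : Problem U (Finset U) where
  weights := W
  points := id
  feasible X := {S | S ∈ clusterSolutions k X ∧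
    clusterCost z S X ≤ α * ⨅ T ∈ clusterSolutions k X, clusterCost z T X}

/-- Constructing an `ε`-coreset. -/
noncomputable def clusterCoresetProblem (U : Type u) [MetricSpace U] (W : Set ℝ≥0) (z k : ℕ)
    (ε : ℝ≥0) : Problem U (U →₀ ℝ≥0) where
  weights := W
  points := Finsupp.support
  feasible X := {C | C.support ⊆ X.support ∧ ∀ S ∈ clusterSolutions k X,
    (1 - (ε : ℝ≥0∞)) * clusterCost z S C ≤ clusterCost z S X ∧
      clusterCost z S X ≤ (1 + (ε : ℝ≥0∞)) * clusterCost z S C}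

/-! The memory is a random encoding of the input. Compliance makes it decodable: query, delete a
point of the answer, repeat. A feasible answer names a present point, so the deletion is legal, and
the deleted points spell out the input. Deletions depend on answers, which is where adaptivity is
needed. One query is asked at each size `s ≤ k`, so by the union bound decoding a `k`-set fails with
probability at most `∑ 1/(8s²) ≤ 1/4` (`DynAlg.one_le_expect_recoverSet`).

The decoder `recoverSet` sees only the memory. If all memories had fewer than `L` bits, each
`k`-subset `Y` of a fixed `2k`-set would satisfy `∑ₘ Pr[m decodes to Y] ≥ 3/4`, the sum being over
the at most `2^L - 1` short strings. For each `m` these probabilities sum to at most 1 over `Y`,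
whence `(3/4) * C(2k,k) ≤ 2^L - 1`. Since `C(2k,k) ≥ 2^k`, this bounds `L` from below
(`DynAlg.exists_le_length_memory`).

For clustering, the empty solution has infinite cost on a nonempty input, hence is never feasible.
-/

/-- The expectation of `f` under `p`. -/
noncomputable def PMF.expect {α : Type*} (p : PMF α) (f : α → ℝ≥0∞) : ℝ≥0∞ := ∑' a, p a * f a

/-! ### Expectations of `ℝ≥0∞`-valued functions. -/

namespace PMF

variable {α β : Type*}

theorem expect_pure (a : α) (f : α → ℝ≥0∞) : (PMF.pure a).expect f = f a := by
  classical
  rw [expect, tsum_eq_single a]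
  · simp
  · intro b hb
    simp [PMF.pure_apply, hb]

theorem expect_bind (p : PMF α) (q : α → PMF β) (f : β → ℝ≥0∞) :
    (p.bind q).expect f = p.expect fun a => (q a).expect f := by
  simp only [expect, PMF.bind_apply, ← ENNReal.tsum_mul_right, ← ENNReal.tsum_mul_left]
  rw [ENNReal.tsum_comm]
  simp only [mul_assoc]

theorem expect_map (p : PMF α) (g : α → β) (f : β → ℝ≥0∞) :
    (p.map g).expect f = p.expect fun a => f (g a) := by
  rw [PMF.map, expect_bind]
  simp only [Function.comp_apply, expect_pure]

theorem expect_mono (p : PMF α) {f g : α → ℝ≥0∞} (h : ∀ a, f a ≤ g a) :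
    p.expect f ≤ p.expect g :=
  ENNReal.tsum_le_tsum fun a => mul_le_mul_right (h a) _

theorem expect_add (p : PMF α) (f g : α → ℝ≥0∞) :
    (p.expect fun a => f a + g a) = p.expect f + p.expect g := by
  simp only [expect, mul_add, ENNReal.tsum_add]

theorem expect_const (p : PMF α) (c : ℝ≥0∞) : (p.expect fun _ => c) = c := by
  rw [expect, ENNReal.tsum_mul_right, p.tsum_coe, one_mul]

theorem expect_le_of_le (p : PMF α) {f : α → ℝ≥0∞} {c : ℝ≥0∞} (h : ∀ a, f a ≤ c) :
    p.expect f ≤ c :=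
  (p.expect_mono h).trans_eq (p.expect_const c)

theorem toOuterMeasure_eq_expect (p : PMF α) (s : Set α) :
    p.toOuterMeasure s = p.expect (s.indicator 1) := by
  rw [PMF.toOuterMeasure_apply, expect]
  congr 1
  ext a
  by_cases h : a ∈ s <;> simp [h]

open Classical in
theorem apply_add_expect_ne (p : PMF α) (a : α) :
    p a + p.expect (fun b => if b = a then 0 else 1) = 1 := by
  have h : p a = p.expect fun b => if b = a then 1 else 0 := by
    rw [expect, tsum_eq_single a]
    · simp
    · intro b hb
      simp [hb]
  rw [h, ← expect_add]
  refine (congrArg p.expect ?_).trans (p.expect_const 1)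
  ext b
  by_cases hb : b = a <;> simp [hb]

/-- Bounding the weights `p a` by 1 removes the dependence on `p`. In the counting argument `p` is
the memory law, which varies with the encoded set. -/
theorem expect_le_sum (p : PMF α) {s : Finset α} (hs : ∀ a ∈ p.support, a ∈ s) (f : α → ℝ≥0∞) :
    p.expect f ≤ ∑ a ∈ s, f a := by
  rw [expect, tsum_eq_sum (s := s)]
  · exact Finset.sum_le_sum fun a _ => (mul_le_mul_left (p.coe_le_one a) _).trans_eq (one_mul _)
  · intro a ha
    rw [p.apply_eq_zero_iff a |>.2 fun h => ha (hs a h), zero_mul]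

end PMF

/-! ### Decoding the input from the memory by queries and deletions. -/

section Recovery

variable {U : Type u} {O : Type v}

open Classical in
/-- The law of the set of points collected from the memory `m` in `i` rounds, each of which asks a
query, picks a point by means of `pick` from the answer, and deletes that point. -/
noncomputable def DynAlg.recoverSet (A : DynAlg U O) (pick : O → U) :
    ℕ → List Bool → PMF (Finset U)
  | 0, _ => PMF.pure ∅
  | i + 1, m => (A.query m).bind fun r =>
      (A.delete (pick r.2) r.1).bind fun m' => (A.recoverSet pick i m').map fun Z => Insert.insert (pick r.2) Z

open Classical in
/-- The probability that `i` rounds do not recover the set `Y`. -/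
noncomputable def DynAlg.recoverFailure (A : DynAlg U O) (pick : O → U) (i : ℕ) (Y : Finset U)
    (m : List Bool) : ℝ≥0∞ :=
  (A.recoverSet pick i m).expect fun Z => if Z = Y then 0 else 1

/-- The operation that the recovering adversary would like to issue: insert the points of `l`, then
alternate between queries and deletions of a point of the last answer. -/
def recoverOp (pick : O → U) (w : ℝ≥0) (l : List U) (h : Transcript U O) : DynOp U :=
  match l.reverse[h.length]?, h with
  | some p, _ => .insert p w
  | none, (.query, some o) :: _ => .delete (pick o)
  | none, _ => .query

open Classical in
/-- The recovering adversary, with illegal operations replaced by queries. -/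
noncomputable def recoverAdversary (P : Problem U O) (pick : O → U) (w : ℝ≥0) (l : List U) :
    Adversary U O := fun h =>
  if P.LegalOp (currentInput h) (recoverOp pick w l h) then recoverOp pick w l h else .query

theorem legal_recoverAdversary (P : Problem U O) (pick : O → U) (w : ℝ≥0) (l : List U) :
    P.LegalAdversary (recoverAdversary P pick w l) := by
  intro h
  unfold recoverAdversary
  split_ifs with hl
  · exact hl
  · trivial

/-- The transcript of inserting the points of `l`, the last entry first. -/
def insertTranscript (O : Type v) (w : ℝ≥0) (l : List U) : Transcript U O :=
  l.map fun p => (.insert p w, none)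

open Classical in
theorem support_currentInput_insertTranscript {w : ℝ≥0} (hw : 0 < w) (l : List U) :
    (currentInput (insertTranscript O w l)).support = l.toFinset := by
  induction l with
  | nil => simp [insertTranscript, currentInput]
  | cons p l ih =>
    rw [List.toFinset_cons, ← ih]
    simp only [insertTranscript, List.map_cons, currentInput, DynOp.apply]
    exact Finsupp.support_update_ne_zero _ _ hw.ne'

open Classical in
theorem currentInput_insertTranscript_apply (w : ℝ≥0) (l : List U) (p : U) :
    currentInput (insertTranscript O w l) p = if p ∈ l then w else 0 := by
  induction l with
  | nil => simp [insertTranscript, currentInput]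
  | cons q l ih =>
    simp only [insertTranscript, List.map_cons, currentInput, DynOp.apply] at ih ⊢
    rw [Finsupp.update_apply, ih]
    by_cases h : p = q <;> simp [h]

theorem admissible_insertTranscript {P : Problem U O} {w : ℝ≥0} (hw : w ∈ P.weights)
    (l : List U) : P.Admissible (currentInput (insertTranscript O w l)) := by
  classical
  intro p hp
  rw [Finsupp.mem_support_iff] at hp
  rw [currentInput_insertTranscript_apply] at hp ⊢
  split_ifs at hp ⊢ with h
  · exact hw
  · exact absurd rfl hp

theorem admissible_erase {P : Problem U O} {X : U →₀ ℝ≥0} (hX : P.Admissible X) (p : U) :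
    P.Admissible (X.erase p) := by
  classical
  intro q hq
  rw [Finsupp.support_erase, Finset.mem_erase] at hq
  rw [Finsupp.erase_ne hq.1]
  exact hX q hq.2

theorem length_insertTranscript (w : ℝ≥0) (l : List U) :
    (insertTranscript O w l).length = l.length := by
  simp [insertTranscript]

theorem recoverAdversary_insert {P : Problem U O} (pick : O → U) {w : ℝ≥0} (hw : w ∈ P.weights)
    (hw0 : 0 < w) {l₁ l₂ : List U} {p : U} (hl : (l₁ ++ p :: l₂).Nodup) :
    recoverAdversary P pick w (l₁ ++ p :: l₂) (insertTranscript O w l₂) = .insert p w := by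
  classical
  have hop : recoverOp pick w (l₁ ++ p :: l₂) (insertTranscript O w l₂) = .insert p w := by
    have : (l₁ ++ p :: l₂).reverse[(insertTranscript O w l₂).length]? = some p := by
      simp [length_insertTranscript]
    unfold recoverOp
    rw [this]
  have hp : p ∉ l₂ := (List.nodup_cons.1 (List.nodup_append.1 hl).2.1).1
  rw [recoverAdversary, hop, if_pos]
  refine ⟨?_, hw0, hw⟩
  rw [support_currentInput_insertTranscript hw0]
  simpa using hp

/-- The adversary depends on the whole list, so the induction runs over the part `l₂` already
inserted, with the points `l₁` still to come left general. -/
theorem DynAlg.run_recoverAdversary_insert (A : DynAlg U O) {P : Problem U O} (pick : O → U)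
    {w : ℝ≥0} (hw : w ∈ P.weights) (hw0 : 0 < w) (l₁ l₂ : List U) (hl : (l₁ ++ l₂).Nodup) :
    A.run (recoverAdversary P pick w (l₁ ++ l₂)) l₂.length =
      (A.memoryAfterInserting w l₂).map fun m => (m, insertTranscript O w l₂) := by
  induction l₂ generalizing l₁ with
  | nil => rfl
  | cons p l₂ ih =>
    have h := ih (l₁ ++ [p]) (by simpa using hl)
    rw [List.append_assoc, List.singleton_append] at h
    rw [List.length_cons, DynAlg.run, h, DynAlg.memoryAfterInserting, PMF.bind_map, PMF.map_bind]
    congr 1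
    ext1 m
    simp only [Function.comp_apply, recoverAdversary_insert pick hw hw0 hl, DynAlg.step,
      PMF.map_comp]
    rfl

theorem recoverOp_of_length_le (pick : O → U) (w : ℝ≥0) {l : List U} {h : Transcript U O}
    (hl : l.length ≤ h.length) (o : O) :
    recoverOp pick w l ((.query, some o) :: h) = .delete (pick o) := by
  have : l.reverse[((DynOp.query, some o) :: h : Transcript U O).length]? = none := by
    simp; omega
  unfold recoverOp
  rw [this]

theorem recoverOp_delete (pick : O → U) (w : ℝ≥0) {l : List U} {h : Transcript U O}
    (hl : l.length ≤ h.length) (p : U) :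
    recoverOp pick w l ((.delete p, none) :: h) = .query := by
  have : l.reverse[((DynOp.delete p, none) :: h : Transcript U O).length]? = none := by
    simp; omega
  unfold recoverOp
  rw [this]

theorem recoverAdversary_of_recoverOp_eq_query {P : Problem U O} {pick : O → U} {w : ℝ≥0}
    {l : List U} {h : Transcript U O} (hq : recoverOp pick w l h = .query) :
    recoverAdversary P pick w l h = .query := by
  rw [recoverAdversary, hq, ite_self]

/-- The recovering adversary has inserted its points and is about to ask a query on an input of
size `i`. -/
def ReadyToQuery (P : Problem U O) (pick : O → U) (w : ℝ≥0) (l : List U) (i : ℕ)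
    (h : Transcript U O) : Prop :=
  l.length ≤ h.length ∧ recoverAdversary P pick w l h = .query ∧
    (currentInput h).support.card = i ∧ P.Admissible (currentInput h)

open Classical in
/-- The probability that the recovering adversary has `i` points left to recover after `t`
operations and that the remaining `i` rounds will not recover them. -/
noncomputable def DynAlg.pendingFailure (A : DynAlg U O) (P : Problem U O) (pick : O → U) (w : ℝ≥0)
    (l : List U) (t i : ℕ) : ℝ≥0∞ :=
  (A.run (recoverAdversary P pick w l) t).expect fun c =>
    if ReadyToQuery P pick w l i c.2 then
      A.recoverFailure pick i (currentInput c.2).support c.1 else 0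

theorem DynAlg.run_succ_expect (A : DynAlg U O) (adv : Adversary U O) (t : ℕ)
    (f : List Bool × Transcript U O → ℝ≥0∞) :
    (A.run adv (t + 1)).expect f = (A.run adv t).expect fun c =>
      (A.step c.1 (adv c.2)).expect fun r => f (r.1, (adv c.2, r.2) :: c.2) := by
  rw [DynAlg.run, PMF.expect_bind]
  simp only [PMF.expect_map]

open Classical in
theorem DynAlg.recoverFailure_succ (A : DynAlg U O) (pick : O → U) (i : ℕ) (Y : Finset U)
    (m : List Bool) : A.recoverFailure pick (i + 1) Y m = (A.query m).expect fun r =>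
      (A.delete (pick r.2) r.1).expect fun m' =>
        (A.recoverSet pick i m').expect fun Z => if Insert.insert (pick r.2) Z = Y then 0 else 1 := by
  simp only [recoverFailure, recoverSet, PMF.expect_bind, PMF.expect_map]

/-- One round costs two operations, a query and a deletion. An infeasible answer is charged to `δ (i
+ 1)`; a feasible one leads to the same situation with one point fewer. -/
theorem DynAlg.pendingFailure_succ_le (A : DynAlg U O) {P : Problem U O} (hP : P.Compliant)
    {pick : O → U} (hpick : ∀ o, (P.points o).Nonempty → pick o ∈ P.points o)
    {δ : ℕ → ℝ≥0∞} (hA : A.WorksAgainstAdaptiveAdversary P δ) (w : ℝ≥0) (l : List U) (t i : ℕ) :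
    A.pendingFailure P pick w l t (i + 1) ≤
      δ (i + 1) + A.pendingFailure P pick w l (t + 2) i := by
  classical
  refine le_trans ?_ (add_le_add_left
    (hA _ (legal_recoverAdversary P pick w l) t (i + 1) (by omega)) _)
  rw [PMF.toOuterMeasure_eq_expect, pendingFailure, pendingFailure, run_succ_expect,
    run_succ_expect A _ (t + 1), run_succ_expect, ← PMF.expect_add]
  refine PMF.expect_mono _ fun c => ?_
  obtain ⟨m, h⟩ := c
  dsimp only
  split_ifs with hr
  swap
  · exact zero_le
  obtain ⟨hlen, hq, hcard, hadm⟩ := hr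
  rw [hq, ← PMF.expect_add, recoverFailure_succ]
  simp only [step, PMF.expect_map]
  refine PMF.expect_mono _ fun r => ?_
  obtain ⟨m', o⟩ := r
  dsimp only
  by_cases ho : o ∈ P.feasible (currentInput h)
  swap
  -- After an infeasible answer the failure of the remaining rounds is bounded by 1, the indicator
  -- of the bad event.
  · refine le_trans (le_trans (b := 1) ?_ (le_of_eq ?_)) le_self_add
    · exact PMF.expect_le_of_le _ fun m'' => PMF.expect_le_of_le _ fun Z => by split_ifs <;> simp
    · rw [Set.indicator_of_mem]
      · rfl
      · exact ⟨o, h, rfl, hcard, ho⟩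
  · refine le_trans ?_ le_add_self
    obtain ⟨hsub, hne⟩ := hP _ hadm o ho
    have hmem : pick o ∈ (currentInput h).support :=
      hsub (hpick o (hne (Finset.card_pos.1 (by omega))))
    have hadv : recoverAdversary P pick w l ((.query, some o) :: h) = .delete (pick o) := by
      rw [recoverAdversary, recoverOp_of_length_le pick w hlen, if_pos]
      exact hmem
    rw [hadv]
    simp only [PMF.expect_map]
    refine PMF.expect_mono _ fun m'' => ?_
    have hsupp : (currentInput ((.delete (pick o), none) :: (.query, some o) :: h :
        Transcript U O)).support = (currentInput h).support.erase (pick o) := by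
      simp only [currentInput, DynOp.apply]
      convert Finsupp.support_erase
    have hready : ReadyToQuery P pick w l i
        ((.delete (pick o), none) :: (.query, some o) :: h) := by
      refine ⟨?_, ?_, ?_, ?_⟩
      · simp only [List.length_cons]; omega
      · exact recoverAdversary_of_recoverOp_eq_query
          (recoverOp_delete pick w (by simp only [List.length_cons]; omega) _)
      · rw [hsupp, Finset.card_erase_of_mem hmem, hcard, Nat.add_sub_cancel]
      · exact admissible_erase hadm _
    rw [if_pos hready, recoverFailure, hsupp]
    refine PMF.expect_mono _ fun Z => ?_
    -- Only one direction is needed: if the later rounds recover the input without `pick o`, then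
    -- adding `pick o` recovers the input.
    by_cases hZ : Z = (currentInput h).support.erase (pick o)
    · rw [if_pos, if_pos hZ]
      rw [hZ, Finset.insert_erase hmem]
    · rw [if_neg hZ]
      split_ifs <;> simp

theorem DynAlg.pendingFailure_le (A : DynAlg U O) {P : Problem U O} (hP : P.Compliant)
    {pick : O → U} (hpick : ∀ o, (P.points o).Nonempty → pick o ∈ P.points o)
    {δ : ℕ → ℝ≥0∞} (hA : A.WorksAgainstAdaptiveAdversary P δ) (w : ℝ≥0) (l : List U) (t i : ℕ) :
    A.pendingFailure P pick w l t i ≤ ∑ s ∈ Finset.range i, δ (s + 1) := by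
  classical
  induction i generalizing t with
  | zero =>
    refine PMF.expect_le_of_le _ fun c => ?_
    split_ifs with hr
    · have h0 : (currentInput c.2).support = ∅ := Finset.card_eq_zero.1 hr.2.2.1
      simp [recoverFailure, recoverSet, PMF.expect_pure, h0]
    · exact zero_le
  | succ i ih =>
    rw [Finset.sum_range_succ, add_comm (∑ s ∈ _, _)]
    exact (A.pendingFailure_succ_le hP hpick hA w l t i).trans (add_le_add_right (ih _) _)

/-- Querying and deleting recovers the input from the memory, up to the sum of the failure
probabilities. -/
theorem DynAlg.one_le_expect_recoverSet (A : DynAlg U O) {P : Problem U O} (hP : P.Compliant)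
    {pick : O → U} (hpick : ∀ o, (P.points o).Nonempty → pick o ∈ P.points o)
    {δ : ℕ → ℝ≥0∞} (hA : A.WorksAgainstAdaptiveAdversary P δ) {w : ℝ≥0} (hw : w ∈ P.weights)
    (hw0 : 0 < w) {Y : Finset U} {l : List U} (hl : l.Nodup) (hY : ∀ p, p ∈ l ↔ p ∈ Y) :
    1 ≤ ((A.memoryAfterInserting w l).expect fun m => A.recoverSet pick Y.card m Y) +
      ∑ s ∈ Finset.range Y.card, δ (s + 1) := by
  classical
  obtain rfl : l.toFinset = Y := by ext p; simp [hY]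
  have hF := A.pendingFailure_le hP hpick hA w l l.length l.toFinset.card
  have hsupp := support_currentInput_insertTranscript (O := O) hw0 l
  have hready : ReadyToQuery P pick w l l.toFinset.card (insertTranscript O w l) := by
    refine ⟨(length_insertTranscript w l).ge, recoverAdversary_of_recoverOp_eq_query ?_, ?_,
      admissible_insertTranscript hw l⟩
    · have : l.reverse[(insertTranscript O w l).length]? = none := by
        simp [length_insertTranscript]
      unfold recoverOp
      rw [this]
      cases l <;> rfl
    · convert congrArg Finset.card hsupp
  have hrun := A.run_recoverAdversary_insert pick hw hw0 [] l hl
  rw [List.nil_append] at hrun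
  rw [pendingFailure, hrun, PMF.expect_map] at hF
  simp only [if_pos hready] at hF
  refine le_trans (le_of_eq ?_) (add_le_add_right hF _)
  rw [← PMF.expect_add]
  refine ((congrArg _ ?_).trans (PMF.expect_const _ 1)).symm
  ext1 m
  rw [recoverFailure, hsupp]
  convert PMF.apply_add_expect_ne _ _

end Recovery

/-! ### Numerical estimates. -/

section Counting

theorem exists_finset_bitStrings_length_lt (L : ℕ) :
    ∃ s : Finset (List Bool), (∀ m : List Bool, m.length < L → m ∈ s) ∧ s.card ≤ 2 ^ L - 1 := by
  classical
  refine ⟨(Finset.range L).biUnion fun i =>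
    (Finset.univ : Finset (List.Vector Bool i)).image List.Vector.toList, fun m hm => ?_, ?_⟩
  · exact Finset.mem_biUnion.2 ⟨m.length, Finset.mem_range.2 hm,
      Finset.mem_image.2 ⟨(⟨m, rfl⟩ : List.Vector Bool m.length), Finset.mem_univ _, rfl⟩⟩
  · refine Finset.card_biUnion_le.trans ?_
    have hgeom := Nat.geomSum_eq le_rfl L
    rw [Nat.add_one_sub_one, Nat.div_one] at hgeom
    rw [← hgeom]
    refine Finset.sum_le_sum fun i _ => Finset.card_image_le.trans ?_
    simp

/-- Consecutive central binomial coefficients have ratio `2(2k+1)/(k+1) ≥ 2`. -/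
theorem two_pow_le_centralBinom (k : ℕ) : 2 ^ k ≤ k.centralBinom := by
  induction k with
  | zero => simp
  | succ k ih =>
    have h := Nat.succ_mul_centralBinom_succ k
    have : (k + 1) * 2 ^ (k + 1) ≤ (k + 1) * (k + 1).centralBinom := by
      rw [h, pow_succ]
      nlinarith
    exact Nat.le_of_mul_le_mul_left this k.succ_pos

theorem sum_range_one_div_eight_mul_sq_le (k : ℕ) :
    ∑ s ∈ Finset.range k, 1 / (8 * ((s + 1 : ℕ) : ℝ≥0∞) ^ 2) ≤ 1 / 4 := by
  -- The subtracted term makes the induction close, by telescoping `1/(s+1)² ≤ 1/s - 1/(s+1)`;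
  -- equality holds for the single term `1/8`.
  have hreal : ∀ k : ℕ, ∑ s ∈ Finset.range (k + 1), 1 / (8 * ((s + 1 : ℕ) : ℝ) ^ 2) ≤
      1 / 4 - 1 / (8 * (k + 1 : ℝ)) := by
    intro k
    induction k with
    | zero => norm_num
    | succ k ih =>
      rw [Finset.sum_range_succ]
      refine (add_le_add_left ih _).trans ?_
      have hk : (0 : ℝ) ≤ k := k.cast_nonneg
      push_cast
      have : 1 / (8 * (k + 1 : ℝ)) - 1 / (8 * (k + 1 + 1 : ℝ)) -
          1 / (8 * (k + 1 + 1 : ℝ) ^ 2) = 1 / (8 * (k + 1) * (k + 1 + 1 : ℝ) ^ 2) := by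
        field_simp
        ring
      have h2 : 0 ≤ 1 / (8 * (k + 1) * (k + 1 + 1 : ℝ) ^ 2) := by positivity
      linarith
  have hle : ∑ s ∈ Finset.range k, 1 / (8 * ((s + 1 : ℕ) : ℝ) ^ 2) ≤ 1 / 4 := by
    refine (Finset.sum_le_sum_of_subset_of_nonneg
      (Finset.range_subset_range.2 k.le_succ) fun _ _ _ => by positivity).trans ((hreal k).trans ?_)
    have : 0 ≤ 1 / (8 * (k + 1 : ℝ)) := by positivity
    linarith
  have hterm : ∀ s : ℕ, 1 / (8 * ((s + 1 : ℕ) : ℝ≥0∞) ^ 2) =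
      ENNReal.ofReal (1 / (8 * ((s + 1 : ℕ) : ℝ) ^ 2)) := by
    intro s
    rw [ENNReal.ofReal_div_of_pos (by positivity), ENNReal.ofReal_mul (by norm_num),
      ENNReal.ofReal_pow (by positivity), ENNReal.ofReal_natCast]
    simp
  simp only [hterm]
  rw [← ENNReal.ofReal_sum_of_nonneg fun _ _ => by positivity]
  refine (ENNReal.ofReal_le_ofReal hle).trans (le_of_eq ?_)
  rw [ENNReal.ofReal_div_of_pos (by norm_num)]
  simp

end Counting

/-! ### The double count behind the space bound. -/

/-- If sets of size `k` of a universe of size at least `2k` are to be recovered from the memory,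
then some of them need `L` bits, unless `2 ^ L` is too large in comparison with the number of
sets. -/
theorem DynAlg.exists_le_length_memory {U : Type u} {O : Type v} {P : Problem U O} (A : DynAlg U O)
    (hP : P.Compliant)
    (hA : A.WorksAgainstAdaptiveAdversary P (fun n => 1 / (8 * (n : ℝ≥0∞) ^ 2)))
    {w : ℝ≥0} (hw : w ∈ P.weights) (hw0 : 0 < w) {k L : ℕ} (hk : 1 ≤ k)
    (hU : ((2 * k : ℕ) : ℕ∞) ≤ ENat.card U) (hL : 4 * (2 ^ L - 1) < 3 * 2 ^ k) :
    ∃ l : List U, l.Nodup ∧ l.length = k ∧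
      ∃ m ∈ (A.memoryAfterInserting w l).support, L ≤ m.length := by
  classical
  by_contra! hshort
  obtain ⟨V, -, hV⟩ : ∃ V : Set U, V ⊆ Set.univ ∧ V.encard = ((2 * k : ℕ) : ℕ∞) :=
    Set.exists_subset_encard_eq (by rwa [Set.encard_univ])
  have hVfin : V.Finite := Set.finite_of_encard_eq_coe hV
  obtain ⟨V, rfl⟩ := hVfin.exists_finset_coe
  rw [Set.encard_coe_eq_coe_finsetCard, Nat.cast_inj] at hV
  obtain ⟨u₀, -⟩ : V.Nonempty := Finset.card_pos.1 (by omega)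
  -- The choice of point depends on the answer alone, so the decoder is the same for all sets `Y`;
  -- `u₀` is a default for answers without points.
  let pick : O → U := fun o => if h : (P.points o).Nonempty then h.choose else u₀
  have hpick : ∀ o, (P.points o).Nonempty → pick o ∈ P.points o := fun o h => by
    simp only [pick, dif_pos h]
    exact h.choose_spec
  obtain ⟨s, hs, hscard⟩ := exists_finset_bitStrings_length_lt L
  have hrec : ∀ Y ∈ V.powersetCard k, (3 / 4 : ℝ≥0∞) ≤ ∑ m ∈ s, A.recoverSet pick k m Y := by
    intro Y hY
    have hYk := (Finset.mem_powersetCard.1 hY).2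
    have h1 := A.one_le_expect_recoverSet hP hpick hA hw hw0 Y.nodup_toList
      (fun p => Finset.mem_toList)
    have h2 := PMF.expect_le_sum (A.memoryAfterInserting w Y.toList) (s := s)
      (fun m hm => hs m (hshort _ Y.nodup_toList (by simpa using hYk) m hm))
      fun m => A.recoverSet pick k m Y
    rw [hYk] at h1
    have h3 := h1.trans (add_le_add h2 (sum_range_one_div_eight_mul_sq_le k))
    refine ENNReal.le_of_add_le_add_right (a := 1 / 4) (by simp) (le_trans (le_of_eq ?_) h3)
    rw [← ENNReal.add_div]
    norm_num
    exact ENNReal.div_self (by norm_num) (by norm_num)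
  have hsum : (V.powersetCard k).card • (3 / 4 : ℝ≥0∞) ≤ s.card • 1 := by
    refine (Finset.card_nsmul_le_sum _ _ _ hrec).trans ?_
    -- For a fixed memory, the probabilities of decoding to the various `Y` belong to one law, so
    -- they sum to at most 1.
    rw [Finset.sum_comm]
    refine Finset.sum_le_card_nsmul _ _ _ fun m _ => ?_
    exact (ENNReal.sum_le_tsum _).trans_eq (PMF.tsum_coe _)
  rw [Finset.card_powersetCard, hV, ← Nat.centralBinom_eq_two_mul_choose, nsmul_eq_mul,
    nsmul_eq_mul, mul_one, ← mul_div_assoc, ENNReal.div_le_iff (by norm_num) (by norm_num)] at hsum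
  norm_cast at hsum
  have := two_pow_le_centralBinom k
  omega

/-- For `L < k` the slack is a factor of 2. The case `L ≤ 1` is needed for `k = 1` and relies on the
`-1`: the only string shorter than one bit is the empty one. -/
theorem four_mul_two_pow_sub_one_lt {k L : ℕ} (hk : 1 ≤ k) (h : L < k ∨ L ≤ 1) :
    4 * (2 ^ L - 1) < 3 * 2 ^ k := by
  rcases h with h | h
  · have : 2 * 2 ^ L ≤ 2 ^ k := by
      rw [← pow_succ']
      exact Nat.pow_le_pow_right (by norm_num) h
    have : 0 < 2 ^ k := by positivity
    omega
  · have h1 : 2 ^ L ≤ 2 ^ 1 := Nat.pow_le_pow_right (by norm_num) h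
    have h2 : 2 ^ 1 ≤ 2 ^ k := Nat.pow_le_pow_right (by norm_num) hk
    omega

/-! ### Compliance of the clustering problems. -/

section Clustering

variable {U : Type u} [MetricSpace U]

theorem clusterCost_empty (z : ℕ) {X : U →₀ ℝ≥0} (hX : X.support.Nonempty) :
    clusterCost z ∅ X = ∞ := by
  obtain ⟨x, hx⟩ := hX
  rw [clusterCost, Finsupp.sum, ENNReal.sum_eq_top]
  refine ⟨x, hx, ?_⟩
  simp [ENNReal.mul_top, Finsupp.mem_support_iff.1 hx]

theorem clusterCost_singleton_ne_top (z : ℕ) (s : U) (X : U →₀ ℝ≥0) :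
    clusterCost z {s} X ≠ ∞ := by
  rw [clusterCost, Finsupp.sum]
  refine ENNReal.sum_ne_top.2 fun x _ => ENNReal.mul_ne_top ENNReal.coe_ne_top ?_
  simp [ENNReal.pow_ne_top (edist_ne_top x s)]

theorem clusterApproxProblem_compliant (W : Set ℝ≥0) (z : ℕ) {k : ℕ} (hk : 1 ≤ k)
    (α : ℝ≥0) : (clusterApproxProblem U W z k α).Compliant := by
  rintro X - S ⟨hS, hcost⟩
  refine ⟨hS.1, fun hX => ?_⟩
  rw [Finset.nonempty_iff_ne_empty]
  rintro hSe
  obtain rfl : S = ∅ := hSe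
  rw [clusterCost_empty z hX, top_le_iff] at hcost
  obtain ⟨x, hx⟩ := hX
  have hmem : {x} ∈ clusterSolutions k X :=
    ⟨Finset.singleton_subset_iff.2 hx, by simpa using hk⟩
  -- As `k ≥ 1`, a single input point is a competitor of finite cost, so the optimum is finite.
  exact ENNReal.mul_ne_top ENNReal.coe_ne_top
    (ne_top_of_le_ne_top (clusterCost_singleton_ne_top z x X) (iInf₂_le _ hmem)) hcost

theorem clusterCoresetProblem_compliant (W : Set ℝ≥0) (z k : ℕ)
    (ε : ℝ≥0) : (clusterCoresetProblem U W z k ε).Compliant := by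
  rintro X - C ⟨hC, hcost⟩
  refine ⟨hC, fun hX => ?_⟩
  rw [Finset.nonempty_iff_ne_empty]
  intro hCe
  obtain rfl : C = 0 := Finsupp.support_eq_empty.1 hCe
  -- The query `S = ∅` separates the two: it costs `∞` on `X` but 0, an empty sum, on the empty
  -- coreset.
  have h := (hcost ∅ ⟨Finset.empty_subset _, by simp⟩).2
  rw [clusterCost_empty z hX] at h
  simp [clusterCost] at h

end Clustering

theorem theorem4p1 :
    -- The space lower bound, in bits, for every compliant problem.
    (∀ (U : Type u) (O : Type v) (P : Problem U O) (A : DynAlg U O),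
      P.Compliant →
      A.WorksAgainstAdaptiveAdversary P (fun n => 1 / (8 * (n : ℝ≥0∞) ^ 2)) →
      ∀ w ∈ P.weights, 0 < w →
        -- some input of size exactly `n` needs `2n/11` bits
        (∀ n : ℕ, 1 ≤ n → ((2 * n : ℕ) : ℕ∞) ≤ ENat.card U →
          ∃ l : List U, l.Nodup ∧ l.length = n ∧
            ∃ m ∈ (A.memoryAfterInserting w l).support,
              (2 / 11 : ℝ) * n ≤ (m.length : ℝ)) ∧
        -- over a universe with only `n` points, some input of size at most `n` does
        (∀ n : ℕ, 2 ≤ n → (n : ℕ∞) ≤ ENat.card U →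
          ∃ l : List U, l.Nodup ∧ l.length ≤ n ∧
            ∃ m ∈ (A.memoryAfterInserting w l).support,
              (2 / 11 : ℝ) * n ≤ (m.length : ℝ))) ∧
    -- Bounded approximation and coresets for `k`-median and `k`-means are compliant problems.
    (∀ (U : Type u) [MetricSpace U] (W : Set ℝ≥0) (z k : ℕ), z = 1 ∨ z = 2 → 1 ≤ k →
      (∀ α : ℝ≥0, (clusterApproxProblem U W z k α).Compliant) ∧
      (∀ ε : ℝ≥0, (clusterCoresetProblem U W z k ε).Compliant)) := by
  refine ⟨fun U O P A hP hA w hw hw0 => ⟨fun n hn hU => ?_, fun n hn hU => ?_⟩, ?_⟩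
  · obtain ⟨l, hl, hlen, m, hm, hmL⟩ := A.exists_le_length_memory hP hA hw hw0
      -- This `L` is `2n/11` rounded up.
      (L := (2 * n + 10) / 11) hn hU (four_mul_two_pow_sub_one_lt hn (by omega))
    refine ⟨l, hl, hlen, m, hm, ?_⟩
    have h : 2 * n ≤ 11 * m.length := by omega
    have h' : (2 * n : ℝ) ≤ 11 * m.length := by exact_mod_cast h
    linarith
  · obtain ⟨l, hl, hlen, m, hm, hmL⟩ := A.exists_le_length_memory hP hA hw hw0
      -- Sets of size `⌊n/2⌋` need only `2⌊n/2⌋ ≤ n` points of the universe.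
      (k := n / 2) (L := (2 * n + 10) / 11) (by omega)
      (le_trans (Nat.cast_le.2 (Nat.mul_div_le n 2)) hU)
      (four_mul_two_pow_sub_one_lt (by omega) (by omega))
    refine ⟨l, hl, by omega, m, hm, ?_⟩
    have h : 2 * n ≤ 11 * m.length := by omega
    have h' : (2 * n : ℝ) ≤ 11 * m.length := by exact_mod_cast h
    linarith
  · intro U _ W z k _ hk
    exact ⟨clusterApproxProblem_compliant W z hk, clusterCoresetProblem_compliant W z k⟩
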